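/- There are absolute constants $C_1,C_2,C_3,C_4>0$ such that the following holds for all integers $K,N\ge 2$ and all $L\in\mathbb N$ with $$C_1 K\le L\le \frac{KN}{36}.$$ There is a matrix $B\in\mathbb{C}^{L\times K}$ with $B^*B=\mathrm{Id}_K$ and $\mu_{\max}^2=1$ such that for all fixed $h_0\in\mathbb{C}^K\setminus\{0\}$ and $m_0\in\mathbb{C}^N\setminus\{0\}$, with probability at least $$1-C_4\exp\left(-C_2K/\mu_{h_0}^2\right)$$ it holds that $$\lambda_{\min}\left(\mathcal A,\mathcal D(h_0m_0^*)\right)\le C_3\sqrt{\frac{L}{KN}}.$$ Here $F\in\mathbb{C}^{L\times L}$ is the unitary discrete Fourier matrix, $b_\ell\in\mathbb{C}^K$ is the $\ell$-th row of $\overline{FB}$, $c_\ell\in\mathbb{C}^N$ is the $\ell$-th row of $\sqrt L\,FC$, and $C\in\mathbb{C}^{L\times N}$ is a random matrix with independent, identically distributed, circularly symmetric complex normal entries of mean $0$ and variance $1/L$. The coherence parameters are $$\mu_{\max}^2=\frac LK\max_{1\le\ell\le L}\|b_\ell\|^2,\qquad \mu_{h_0}^2=\frac{L}{\|h_0\|^2}\max_{1\le\ell\le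 L}|\langle b_\ell,h_0\rangle|^2.$$ The measurement operator $\mathcal A:\mathbb{C}^{K\times N}\to\mathbb{C}^L$ is $$(\mathcal A(X))(\ell)=\langle b_\ell c_\ell^*,X\rangle_F=\operatorname{Tr}\left((b_\ell c_\ell^*)^*X\right).$$ With $\|\cdot\|_*$ the nuclear norm (the sum of the singular values) and $\|\cdot\|_F$ the Frobenius norm, the descent cone at $X_0$ is $$\mathcal D(X_0)=\left\{Z\in\mathbb{C}^{K\times N}:\ \|X_0+\varepsilon Z\|_*\le\|X_0\|_*\text{ for some }\varepsilon>0\right\},$$ and the minimum conic singular value is $$\lambda_{\min}(\mathcal A,\mathcal D(X_0))=\inf_{Z\in\mathcal D(X_0)\setminus\{0\}}\frac{\|\mathcal A(Z)\|}{\|Z\|_F}.$$ -/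

import Mathlib

open MeasureTheory ProbabilityTheory
open scoped Matrix NNReal

namespace BlindDeconv

/-- Frobenius inner product `⟪Z, W⟫_F = Tr (Z^* W)` on complex matrices. -/
noncomputable def frobInner {m n : ℕ} (Z W : Matrix (Fin m) (Fin n) ℂ) : ℂ :=
  Matrix.trace (Zᴴ * W)

/-- Frobenius norm. -/
noncomputable def frobNorm {m n : ℕ} (Z : Matrix (Fin m) (Fin n) ℂ) : ℝ :=
  √(∑ i, ∑ j, ‖Z i j‖ ^ 2)

/-- Nuclear norm: the sum of the singular values of `Z`, viewed as a linear map between Euclidean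
spaces. (Mathlib's sequence of singular values is padded by zeros from the index `n` on.) -/
noncomputable def nuclearNorm {m n : ℕ} (Z : Matrix (Fin m) (Fin n) ℂ) : ℝ :=
  ∑ i : Fin n, (Matrix.toEuclideanLin Z).singularValues i

/-- The rank-one matrix `u v^*`. -/
def outer {m n : ℕ} (u : EuclideanSpace ℂ (Fin m)) (v : EuclideanSpace ℂ (Fin n)) :
    Matrix (Fin m) (Fin n) ℂ :=
  Matrix.of fun i j => u i * star (v j)

/-- Descent cone of the nuclear norm at `X₀`. -/
def descentCone {m n : ℕ} (X₀ : Matrix (Fin m) (Fin n) ℂ) : Set (Matrix (Fin m) (Fin n) ℂ) :=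
  {Z | ∃ ε : ℝ, 0 < ε ∧ nuclearNorm (X₀ + ε • Z) ≤ nuclearNorm X₀}

/-- Minimum conic singular value `inf_{Z ∈ S \ {0}} ‖A Z‖ / ‖Z‖_F` of a linear operator `A` with
respect to a set `S` of matrices. The set of quotients is bounded below by `0`, and it is nonempty
for `S = descentCone X₀` with `X₀ ≠ 0`, which contains `-X₀`. -/
noncomputable def minConicSingularValue {m n L : ℕ}
    (A : Matrix (Fin m) (Fin n) ℂ →ₗ[ℂ] EuclideanSpace ℂ (Fin L))
    (S : Set (Matrix (Fin m) (Fin n) ℂ)) : ℝ :=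
  sInf ((fun Z => ‖A Z‖ / frobNorm Z) '' (S \ {0}))

/-- The normalized (unitary) discrete Fourier matrix of size `L`. -/
noncomputable def dftMatrix (L : ℕ) : Matrix (Fin L) (Fin L) ℂ :=
  Matrix.of fun j k =>
    (1 / (√(L : ℝ) : ℂ)) *
      Complex.exp (-2 * Real.pi * Complex.I * ((j : ℕ) : ℂ) * ((k : ℕ) : ℂ) / (L : ℂ))

/-- `b_ℓ`: the `ℓ`-th row of the entrywise complex conjugate of `F B`. -/
noncomputable def bVec {L K : ℕ} (B : Matrix (Fin L) (Fin K) ℂ) (l : Fin L) :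
    EuclideanSpace ℂ (Fin K) :=
  WithLp.toLp 2 fun k => star ((dftMatrix L * B) l k)

/-- `c_ℓ`: the `ℓ`-th row of `√L F C`. -/
noncomputable def cVec {L N : ℕ} (C : Matrix (Fin L) (Fin N) ℂ) (l : Fin L) :
    EuclideanSpace ℂ (Fin N) :=
  WithLp.toLp 2 fun n => (√(L : ℝ) : ℂ) * (dftMatrix L * C) l n

/-- The blind deconvolution measurement operator
`A(X)(ℓ) = ⟪b_ℓ c_ℓ^*, X⟫_F` associated with the matrices `B` and `C`. -/
noncomputable def measurementOp {L K N : ℕ} (B : Matrix (Fin L) (Fin K) ℂ)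
    (C : Matrix (Fin L) (Fin N) ℂ) :
    Matrix (Fin K) (Fin N) ℂ →ₗ[ℂ] EuclideanSpace ℂ (Fin L) where
  toFun X := WithLp.toLp 2 fun l => frobInner (outer (bVec B l) (cVec C l)) X
  map_add' X Y := by
    ext l
    simp [frobInner, Matrix.mul_add, Matrix.trace_add]
  map_smul' a X := by
    ext l
    simp [frobInner, Matrix.trace_smul]

/-- `μ_max² = (L / K) max_ℓ ‖b_ℓ‖²`. -/
noncomputable def muMaxSq {L K : ℕ} (B : Matrix (Fin L) (Fin K) ℂ) : ℝ :=
  (L : ℝ) / K * ⨆ l : Fin L, ‖bVec B l‖ ^ 2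

/-- `μ_h² = (L / ‖h‖²) max_ℓ |⟪b_ℓ, h⟫|²`. -/
noncomputable def muSq {L K : ℕ} (B : Matrix (Fin L) (Fin K) ℂ)
    (h : EuclideanSpace ℂ (Fin K)) : ℝ :=
  (L : ℝ) / ‖h‖ ^ 2 * ⨆ l : Fin L, ‖inner ℂ (bVec B l) h‖ ^ 2

/-- The circularly symmetric complex normal distribution with mean `0` and variance
`E |z|² = v`: real and imaginary part are independent real normals of variance `v / 2`. -/
noncomputable def complexGaussian (v : ℝ≥0) : Measure ℂ :=
  ((gaussianReal 0 (v / 2)).prod (gaussianReal 0 (v / 2))).map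
    (fun p : ℝ × ℝ => (⟨p.1, p.2⟩ : ℂ))

/-- The random matrix `C` has independent, identically distributed entries with the circularly
symmetric complex normal distribution of variance `1 / L`. -/
structure IsGaussianMatrix {Ω : Type*} [MeasurableSpace Ω] (P : Measure Ω) {L N : ℕ}
    (C : Ω → Matrix (Fin L) (Fin N) ℂ) : Prop where
  measurable : ∀ i j, Measurable fun ω => C ω i j
  law : ∀ i j, P.map (fun ω => C ω i j) = complexGaussian (1 / (L : ℝ≥0))
  indep : iIndepFun (fun (p : Fin L × Fin N) ω => C ω p.1 p.2) P

end BlindDeconv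

/-!
Why the estimate holds. Write `a = L / K`, `ρ = √(L / (K N)) ≤ 1/6`.

*The matrix `B`.* The vectors `b_ℓ` are taken, up to the factor `√(K / L)`, to be a sparse unit-norm
tight frame of `L` real vectors in `ℝ^K` ("spectral tetris", `tetris`): the coordinate `k` is
nonzero only for the at most `2 a` indices `ℓ` of an interval `S_k` around `[k a, (k + 1) a)`, and
the intervals of even `k` are pairwise disjoint (`exists_sparse_frame`).

*The direction.* Fix `k`, let `v` be the orthogonal projection of `m₀` onto the span of
`{c_ℓ : ℓ ∈ S_k}`, and let `z = ± ‖h₀‖ e_k` with the sign chosen such that `Re ⟪h₀, z⟫ ≤ 0`. Then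
`A (z (m₀ - v)^*) = 0`: the factor `⟪b_ℓ, z⟫` vanishes off `S_k` and `⟪m₀ - v, c_ℓ⟫` vanishes on it.
If `‖v‖ ≤ 2 ρ ‖m₀‖`, the matrix `Z = z (m₀ - v)^* - 3 ρ h₀ m₀^*` lies in the descent cone, because
`h₀ m₀^* + ρ Z` is the sum of the rank-one matrices `((1 - 3 ρ²) h₀ + ρ z) m₀^*` and `-ρ z v^*`, and
the nuclear norm of such a sum is at most the sum of the products of the norms
(`outer_smul_add_mem_descentCone`). Since `‖A Z‖ = 3 ρ ‖A (h₀ m₀^*)‖` while `‖Z‖_F` is of order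
`‖h₀‖ ‖m₀‖`, the quotient is of order `ρ` as soon as `‖A (h₀ m₀^*)‖ ≤ 2 ‖h₀‖ ‖m₀‖`
(`minConicSingularValue_le`).

*The probability.* In an orthonormal basis whose first vector is `m₀ / ‖m₀‖` the coordinates of all
`c_ℓ` are independent standard complex Gaussians, by unitary invariance (`map_inner_cVec`). The
bound on `‖A (h₀ m₀^*)‖² = ∑ |⟪b_ℓ, h₀⟫|² |⟪m₀, c_ℓ⟫|²` is a Chernoff estimate and fails with
probability at most `exp (-L / μ²)` (`measureReal_four_le_sum_mul_normSq`). For a single `k` the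
expected value of `‖v‖² / ‖m₀‖²` is at most `|S_k| / N`, as all coordinate vectors are equally likely
to be close to the random span and the squared norms of their projections add up to its dimension.
By Markov's inequality `‖v‖² ≥ 2 (|S_k| / N) ‖m₀‖²` has probability at most `1/2`. These events are
independent for disjoint `S_k`, so that they all occur with probability at most `2^(-K/2)`
(`measureReal_forall_two_mul_le_projSq`); it is enough that one of them fails. As `μ_{h₀} ≥ 1`
(`one_le_muSq`), both failure probabilities are at most `exp (-K / (4 μ²))`.
-/

namespace BlindDeconv

/-! ### Nuclear norms of sums of rank-one matrices -/

lemma toEuclideanLin_outer {m n : ℕ} (u : EuclideanSpace ℂ (Fin m))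
    (v x : EuclideanSpace ℂ (Fin n)) :
    Matrix.toEuclideanLin (outer u v) x = inner ℂ v x • u := by
  ext i
  simp [Matrix.toLpLin_apply, outer, Matrix.mulVec, dotProduct, PiLp.inner_apply, Finset.mul_sum,
    mul_comm, mul_left_comm]

section SingularVectors

variable {E F : Type*} [NormedAddCommGroup E] [InnerProductSpace ℂ E] [FiniteDimensional ℂ E]
  [NormedAddCommGroup F] [InnerProductSpace ℂ F] [FiniteDimensional ℂ F]

/-- An orthonormal basis of right singular vectors. -/
lemma exists_orthonormalBasis_inner_apply {n : ℕ} (hn : Module.finrank ℂ E = n) (T : E →ₗ[ℂ] F) :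
    ∃ e : OrthonormalBasis (Fin n) ℂ E, ∀ i j,
      inner ℂ (T (e i)) (T (e j)) = if i = j then ((T.singularValues j : ℂ)) ^ 2 else 0 := by
  refine ⟨T.isSymmetric_adjoint_comp_self.eigenvectorBasis hn, fun i j => ?_⟩
  set e := T.isSymmetric_adjoint_comp_self.eigenvectorBasis hn
  have h := T.isSymmetric_adjoint_comp_self.apply_eigenvectorBasis hn j
  rw [← T.sq_singularValues_fin hn j] at h
  rw [← LinearMap.adjoint_inner_right, ← LinearMap.comp_apply, h, inner_smul_right,
    orthonormal_iff_ite.mp e.orthonormal i j]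
  split_ifs <;> simp

/-- The sum of the singular values is dominated by the sum of the products of norms in any
representation of `T` as a sum of rank-one maps. With `e i` the right and `f i` the left singular
vectors, `σ i = ⟪f i, T (e i)⟫`, and the bound follows from the inequalities of Cauchy–Schwarz and
Bessel. -/
lemma sum_singularValues_le {n : ℕ} (hn : Module.finrank ℂ E = n) (T : E →ₗ[ℂ] F)
    {ι : Type*} (s : Finset ι) (u : ι → F) (v : ι → E)
    (hT : ∀ x, T x = ∑ a ∈ s, inner ℂ (v a) x • u a) :
    ∑ i : Fin n, T.singularValues i ≤ ∑ a ∈ s, ‖u a‖ * ‖v a‖ := by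
  obtain ⟨e, he⟩ := exists_orthonormalBasis_inner_apply hn T
  -- Left singular vectors exist only where the singular value is nonzero.
  let J := {i : Fin n // T.singularValues i ≠ 0}
  let f : J → F := fun i => (T.singularValues i : ℂ)⁻¹ • T (e i)
  have hf : Orthonormal ℂ f := by
    rw [orthonormal_iff_ite]
    intro i j
    have hj : (T.singularValues j : ℂ) ≠ 0 := by exact_mod_cast j.2
    simp only [f, inner_smul_left, inner_smul_right, he]
    by_cases h : i = j
    · subst h
      simp
      field_simp
    · rw [if_neg h, if_neg fun h' => h (Subtype.ext h')]
      simp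
  have heJ : Orthonormal ℂ (fun i : J => e i) := e.orthonormal.comp _ Subtype.val_injective
  have hσ : ∀ i : J, (T.singularValues i : ℂ) = inner ℂ (f i) (T (e i)) := by
    intro i
    have hi : (T.singularValues i : ℂ) ≠ 0 := by exact_mod_cast i.2
    simp only [f, inner_smul_left, he]
    simp; field_simp
  have h1 : ∑ i : Fin n, T.singularValues i = ∑ i : J, T.singularValues i := by
    classical
    rw [← Finset.sum_filter_ne_zero]
    exact Finset.sum_subtype _ (by simp) _
  rw [h1]
  have h2 : ∀ i : J, T.singularValues i ≤
      ∑ a ∈ s, ‖inner ℂ (f i) (u a)‖ * ‖inner ℂ (e i) (v a)‖ := by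
    intro i
    have : ‖(T.singularValues i : ℂ)‖ = T.singularValues i := by
      simp [abs_of_nonneg (T.singularValues_nonneg i)]
    rw [← this, hσ i, hT, inner_sum]
    refine (norm_sum_le _ _).trans (Finset.sum_le_sum fun a _ => ?_)
    rw [inner_smul_right, norm_mul, mul_comm, norm_inner_symm (v a)]
  refine (Finset.sum_le_sum fun i _ => h2 i).trans ?_
  rw [Finset.sum_comm]
  refine Finset.sum_le_sum fun a _ => ?_
  refine (Real.sum_mul_le_sqrt_mul_sqrt _ _ _).trans ?_
  gcongr
  · exact Real.sqrt_le_iff.mpr ⟨norm_nonneg _, hf.sum_inner_products_le (u a)⟩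
  · exact Real.sqrt_le_iff.mpr ⟨norm_nonneg _, heJ.sum_inner_products_le (v a)⟩

/-- For a rank-one map `⟪v, ·⟫ u` the sum of the singular values dominates the Hilbert–Schmidt norm
`‖u‖ ‖v‖`. -/
lemma le_sum_singularValues {n : ℕ} (hn : Module.finrank ℂ E = n) (T : E →ₗ[ℂ] F) (u : F) (v : E)
    (hT : ∀ x, T x = inner ℂ v x • u) :
    ‖u‖ * ‖v‖ ≤ ∑ i : Fin n, T.singularValues i := by
  obtain ⟨e, he⟩ := exists_orthonormalBasis_inner_apply hn T
  have h0 : ∀ i : Fin n, 0 ≤ T.singularValues i := fun i => T.singularValues_nonneg i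
  refine le_of_sq_le_sq ?_ (Finset.sum_nonneg fun i _ => h0 i)
  refine le_trans (le_of_eq ?_) (Finset.sum_sq_le_sq_sum_of_nonneg fun i _ => h0 i)
  have h2 : ∀ i : Fin n, T.singularValues i ^ 2 = ‖inner ℂ v (e i)‖ ^ 2 * ‖u‖ ^ 2 := by
    intro i
    have := he i i
    rw [if_pos rfl, inner_self_eq_norm_sq_to_K, hT, norm_smul] at this
    rw [← mul_pow]
    apply Complex.ofReal_injective
    rw [Complex.ofReal_pow, Complex.ofReal_pow]
    exact this.symm
  rw [Finset.sum_congr rfl fun i _ => h2 i, ← Finset.sum_mul, e.sum_sq_norm_inner_left]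
  ring

end SingularVectors

lemma nuclearNorm_outer_add_outer_le {m n : ℕ} (u₁ u₂ : EuclideanSpace ℂ (Fin m))
    (v₁ v₂ : EuclideanSpace ℂ (Fin n)) :
    nuclearNorm (outer u₁ v₁ + outer u₂ v₂) ≤ ‖u₁‖ * ‖v₁‖ + ‖u₂‖ * ‖v₂‖ := by
  refine (sum_singularValues_le (by simp) _ Finset.univ ![u₁, u₂] ![v₁, v₂] fun x => ?_).trans
    (by simp)
  simp [toEuclideanLin_outer]

lemma le_nuclearNorm_outer {m n : ℕ} (u : EuclideanSpace ℂ (Fin m)) (v : EuclideanSpace ℂ (Fin n)) :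
    ‖u‖ * ‖v‖ ≤ nuclearNorm (outer u v) :=
  le_sum_singularValues (by simp) _ u v fun x => toEuclideanLin_outer u v x

lemma frobNorm_eq_norm {m n : ℕ} (Z : Matrix (Fin m) (Fin n) ℂ) :
    frobNorm Z = ‖(WithLp.toLp 2 fun p : Fin m × Fin n => Z p.1 p.2 :
      EuclideanSpace ℂ (Fin m × Fin n))‖ := by
  simp [frobNorm, EuclideanSpace.norm_eq, Fintype.sum_prod_type]

lemma frobNorm_outer {m n : ℕ} (u : EuclideanSpace ℂ (Fin m)) (v : EuclideanSpace ℂ (Fin n)) :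
    frobNorm (outer u v) = ‖u‖ * ‖v‖ := by
  rw [frobNorm, EuclideanSpace.norm_eq, EuclideanSpace.norm_eq, ← Real.sqrt_mul (by positivity),
    Finset.sum_mul_sum]
  simp [outer, mul_pow]

lemma frobNorm_sub_le {m n : ℕ} (Z W : Matrix (Fin m) (Fin n) ℂ) :
    frobNorm Z - frobNorm W ≤ frobNorm (Z - W) := by
  simp only [frobNorm_eq_norm]
  exact norm_sub_norm_le _ _

lemma measurementOp_outer {L K N : ℕ} (B : Matrix (Fin L) (Fin K) ℂ)
    (C : Matrix (Fin L) (Fin N) ℂ) (h : EuclideanSpace ℂ (Fin K)) (m : EuclideanSpace ℂ (Fin N))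
    (l : Fin L) :
    measurementOp B C (outer h m) l = inner ℂ (bVec B l) h * inner ℂ m (cVec C l) := by
  simp only [measurementOp, frobInner, outer, LinearMap.coe_mk, AddHom.coe_mk, Matrix.trace,
    Matrix.diag, Matrix.mul_apply, Matrix.conjTranspose_apply, PiLp.inner_apply, Finset.sum_mul_sum,
    Matrix.of_apply]
  rw [Finset.sum_comm]
  refine Finset.sum_congr rfl fun i _ => Finset.sum_congr rfl fun j _ => ?_
  simp; ring

/-- The witness of the descent condition is `ε = r`. -/
lemma outer_smul_add_mem_descentCone {K N : ℕ} (h z : EuclideanSpace ℂ (Fin K))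
    (m v : EuclideanSpace ℂ (Fin N)) {r : ℝ} (hr : 0 < r) (hr6 : r ≤ 1 / 6)
    (hz : ‖z‖ = ‖h‖) (hzh : (inner ℂ h z).re ≤ 0) (hv : ‖v‖ ≤ 2 * r * ‖m‖) :
    outer z (m - v) - (3 * r) • outer h m ∈ descentCone (outer h m) := by
  refine ⟨r, hr, le_trans ?_ (le_nuclearNorm_outer h m)⟩
  have hdec : outer h m + r • (outer z (m - v) - (3 * r) • outer h m) =
      outer (((1 - 3 * r * r : ℝ) : ℂ) • h + (r : ℂ) • z) m + outer z ((-r : ℂ) • v) := by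
    ext i j
    simp [outer]
    ring
  rw [hdec]
  refine (nuclearNorm_outer_add_outer_le _ _ _ _).trans ?_
  have h1 : ‖((1 - 3 * r * r : ℝ) : ℂ) • h + (r : ℂ) • z‖ ≤ (1 - 2 * r * r) * ‖h‖ := by
    have h13 : 0 ≤ 1 - 3 * r * r := by nlinarith
    refine le_of_sq_le_sq ?_ (mul_nonneg (by nlinarith) (norm_nonneg _))
    rw [@norm_add_sq ℂ, norm_smul, norm_smul, hz, inner_smul_left, inner_smul_right]
    have hre : RCLike.re ((starRingEnd ℂ) ((1 - 3 * r * r : ℝ) : ℂ) * ((r : ℂ) * inner ℂ h z))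
        = (1 - 3 * r * r) * r * (inner ℂ h z).re := by
      rw [Complex.conj_ofReal, ← mul_assoc, ← Complex.ofReal_mul]
      exact Complex.re_ofReal_mul _ _
    rw [hre, Complex.norm_real, Complex.norm_real, Real.norm_of_nonneg h13, Real.norm_of_nonneg hr.le]
    have : (1 - 3 * r * r) * r * (inner ℂ h z).re ≤ 0 :=
      mul_nonpos_of_nonneg_of_nonpos (by positivity) hzh
    -- The difference of the two sides is `r² (1 - 5 r²)`.
    have h2 : (1 - 3 * r * r) ^ 2 + r ^ 2 ≤ (1 - 2 * r * r) ^ 2 := by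
      have h36 : r * r ≤ 1 / 36 := by nlinarith
      nlinarith [mul_nonneg hr.le hr.le]
    nlinarith [mul_le_mul_of_nonneg_right h2 (sq_nonneg ‖h‖)]
  have h2 : ‖(-r : ℂ) • v‖ ≤ r * (2 * r * ‖m‖) := by
    rw [norm_smul, norm_neg, Complex.norm_real, Real.norm_of_nonneg hr.le]
    gcongr
  rw [hz]
  calc _ ≤ (1 - 2 * r * r) * ‖h‖ * ‖m‖ + ‖h‖ * (r * (2 * r * ‖m‖)) := by gcongr
    _ = _ := by ring

/-- Bound on the minimum conic singular value through the explicit direction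
`Z = z (m - v)^* - 3 r h m^*`, whose first summand is annihilated by the measurement operator. -/
lemma minConicSingularValue_le {K N L : ℕ} (B : Matrix (Fin L) (Fin K) ℂ)
    (C : Matrix (Fin L) (Fin N) ℂ) (h z : EuclideanSpace ℂ (Fin K))
    (m v : EuclideanSpace ℂ (Fin N)) (hh : h ≠ 0) (hm : m ≠ 0) {r : ℝ} (hr : 0 < r)
    (hr6 : r ≤ 1 / 6) (hz : ‖z‖ = ‖h‖) (hzh : (inner ℂ h z).re ≤ 0) (hv : ‖v‖ ≤ 2 * r * ‖m‖)
    (hA : ∀ l, inner ℂ (bVec B l) z = 0 ∨ inner ℂ (m - v) (cVec C l) = 0)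
    (hE : ∑ l, ‖inner ℂ (bVec B l) h‖ ^ 2 * ‖inner ℂ m (cVec C l)‖ ^ 2 ≤ 4 * (‖h‖ * ‖m‖) ^ 2) :
    minConicSingularValue (measurementOp B C) (descentCone (outer h m)) ≤ 36 * r := by
  have hpos : 0 < ‖h‖ * ‖m‖ := mul_pos (norm_pos_iff.mpr hh) (norm_pos_iff.mpr hm)
  set Z := outer z (m - v) - (3 * r) • outer h m with hZ
  have hfrob : 1 / 6 * (‖h‖ * ‖m‖) ≤ frobNorm Z := by
    have h3 : (3 * r) • outer h m = outer ((3 * r : ℂ) • h) m := by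
      ext i j; simp [outer]; ring
    rw [hZ, h3]
    refine le_trans ?_ (frobNorm_sub_le _ _)
    rw [frobNorm_outer, frobNorm_outer, norm_smul, hz]
    have h4 : ‖(3 * r : ℂ)‖ = 3 * r := by simp [abs_of_pos hr]
    rw [h4]
    have h5 : (1 - 2 * r) * ‖m‖ ≤ ‖m - v‖ := by linarith [norm_sub_norm_le m v]
    have h6 : ‖h‖ * ((1 - 2 * r) * ‖m‖) ≤ ‖h‖ * ‖m - v‖ := by gcongr
    nlinarith
  have hAZ : measurementOp B C Z = -((3 * r : ℂ) • measurementOp B C (outer h m)) := by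
    have h0 : measurementOp B C (outer z (m - v)) = 0 := by
      ext l
      rw [measurementOp_outer]
      rcases hA l with h | h <;> simp [h]
    have h3 : (3 * r) • outer h m = (3 * r : ℂ) • outer h m := by
      ext i j; simp
    rw [hZ, map_sub, h0, h3, map_smul, zero_sub]
  have hnA : ‖measurementOp B C (outer h m)‖ ≤ 2 * (‖h‖ * ‖m‖) := by
    refine le_of_sq_le_sq ?_ (by positivity)
    rw [EuclideanSpace.norm_sq_eq]
    simp only [measurementOp_outer, norm_mul, mul_pow]
    linarith
  have hne : Z ≠ 0 := by
    intro h0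
    rw [h0] at hfrob
    simp [frobNorm] at hfrob
    linarith
  have hbdd : BddBelow ((fun Z => ‖measurementOp B C Z‖ / frobNorm Z) ''
      (descentCone (outer h m) \ {0})) := by
    refine ⟨0, ?_⟩
    rintro _ ⟨W, -, rfl⟩
    exact div_nonneg (norm_nonneg _) (Real.sqrt_nonneg _)
  refine (csInf_le hbdd ⟨Z, ⟨outer_smul_add_mem_descentCone h z m v hr hr6 hz hzh hv, hne⟩,
    rfl⟩).trans ?_
  · show ‖measurementOp B C Z‖ / frobNorm Z ≤ _
    rw [div_le_iff₀ (by linarith), hAZ, norm_neg, norm_smul]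
    have h4 : ‖(3 * r : ℂ)‖ = 3 * r := by simp [abs_of_pos hr]
    rw [h4]
    calc 3 * r * ‖measurementOp B C (outer h m)‖ ≤ 3 * r * (2 * (‖h‖ * ‖m‖)) := by gcongr
      _ = 36 * r * (1 / 6 * (‖h‖ * ‖m‖)) := by ring
      _ ≤ _ := by gcongr

/-! ### The discrete Fourier matrix is unitary -/

lemma dftMatrix_mem_unitaryGroup (L : ℕ) : dftMatrix L ∈ Matrix.unitaryGroup (Fin L) ℂ := by
  rw [Matrix.mem_unitaryGroup_iff]
  ext i j
  have hL : L ≠ 0 := fun h => by subst h; exact i.elim0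
  have hLC : (L : ℂ) ≠ 0 := by exact_mod_cast hL
  have hζ := Complex.isPrimitiveRoot_exp L hL
  set ζ := Complex.exp (2 * Real.pi * Complex.I / L) with hζdef
  have hζ0 : ζ ≠ 0 := Complex.exp_ne_zero _
  have hF (a b : Fin L) : dftMatrix L a b = (√(L : ℝ) : ℂ)⁻¹ * ((ζ⁻¹) ^ (a : ℕ)) ^ (b : ℕ) := by
    rw [dftMatrix, Matrix.of_apply, one_div, ← pow_mul, hζdef, ← Complex.exp_neg,
      ← Complex.exp_nat_mul]
    congr 2
    push_cast
    ring
  have hconj : (starRingEnd ℂ) ζ = ζ⁻¹ := by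
    rw [hζdef, ← Complex.exp_conj, ← Complex.exp_neg]
    congr 1
    simp [neg_div, Complex.conj_ofNat]
  have hsq : (√(L : ℝ) : ℂ)⁻¹ * (√(L : ℝ) : ℂ)⁻¹ = (L : ℂ)⁻¹ := by
    rw [← mul_inv, ← Complex.ofReal_mul, Real.mul_self_sqrt (by positivity)]
    simp
  set r := (ζ⁻¹) ^ (i : ℕ) * ζ ^ (j : ℕ) with hr
  have hterm (k : Fin L) : dftMatrix L i k * star (dftMatrix L j k) = (L : ℂ)⁻¹ * r ^ (k : ℕ) := by
    rw [hF, hF]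
    simp only [star_mul', Complex.star_def, map_inv₀, map_pow, Complex.conj_ofReal, hconj, inv_inv]
    rw [hr, mul_pow, ← hsq]
    ring
  simp only [Matrix.mul_apply, Matrix.star_apply, hterm]
  rw [← Finset.mul_sum, Fin.sum_univ_eq_sum_range fun k => r ^ k]
  by_cases hij : i = j
  · subst hij
    have : r = 1 := by rw [hr, ← mul_pow, inv_mul_cancel₀ hζ0, one_pow]
    simp [this, hLC]
  · have hr1 : r ≠ 1 := by
      intro h
      apply hij
      rw [hr, inv_pow, inv_mul_eq_one₀ (pow_ne_zero _ hζ0)] at h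
      exact Fin.ext (hζ.pow_inj i.2 j.2 h)
    have hrL : r ^ L = 1 := by
      rw [hr, mul_pow, ← pow_mul, ← pow_mul, mul_comm _ L, mul_comm _ L, pow_mul, pow_mul, inv_pow,
        hζ.pow_eq_one]
      simp
    have : ∑ k ∈ Finset.range L, r ^ k = 0 := by
      have h := geom_sum_mul r L
      rw [hrL, sub_self] at h
      exact (mul_eq_zero.1 h).resolve_right (sub_ne_zero.2 hr1)
    rw [this, Matrix.one_apply_ne hij, mul_zero]

/-! ### A sparse unit-norm tight frame -/

section Frame

/-- Integer part of the `k`-th breakpoint `k L / K`. -/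
def cut (K L k : ℕ) : ℕ := k * L / K

/-- Fractional part of the `k`-th breakpoint `k L / K`. -/
noncomputable def cutFract (K L k : ℕ) : ℝ := ((k * L % K : ℕ) : ℝ) / K

/-- Entry `k` of the `l`-th vector of the sparse unit-norm tight frame of `L` vectors in `ℝ^K`. With
`x` the fractional part of a breakpoint `c = k L / K`, the two vectors with index `⌊c⌋` and `⌊c⌋ + 1`
are `√(x/2) e_{k-1} ± √(1 - x/2) e_k`, so that they contribute `x` to the squared norm of row `k - 1`
(the coordinates of index `k - 1`) and `2 - x` to that of row `k`; for `k = 0` the term with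
`e_{k-1}` is absent, as then `x = 0`. All other vectors are standard basis vectors. -/
noncomputable def tetris (K L l k : ℕ) : ℝ :=
  if l = cut K L k then √(1 - cutFract K L k / 2)
  else if l = cut K L k + 1 then -√(1 - cutFract K L k / 2)
  else if cut K L k ≤ l ∧ l < cut K L (k + 1) then 1
  else if l = cut K L (k + 1) ∨ l = cut K L (k + 1) + 1 then √(cutFract K L (k + 1) / 2)
  else 0

variable {K L : ℕ}

lemma cut_zero : cut K L 0 = 0 := by simp [cut]

lemma cut_self (hK : 0 < K) : cut K L K = L := by simp [cut, hK]

lemma cutFract_zero : cutFract K L 0 = 0 := by simp [cutFract]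

lemma cutFract_self : cutFract K L K = 0 := by simp [cutFract]

lemma cut_add_two_le (hK : 0 < K) (h : 2 * K ≤ L) (k : ℕ) : cut K L k + 2 ≤ cut K L (k + 1) := by
  rw [cut, cut, ← Nat.add_mul_div_right _ _ hK]
  exact Nat.div_le_div_right (by nlinarith)

lemma cut_mono : Monotone (cut K L) := fun _ _ h =>
  Nat.div_le_div_right (Nat.mul_le_mul_right _ h)

lemma cut_le (hK : 0 < K) {k : ℕ} (hk : k ≤ K) : cut K L k ≤ L :=
  (cut_mono hk).trans_eq (cut_self hK)

lemma cutFract_nonneg (k : ℕ) : 0 ≤ cutFract K L k := by unfold cutFract; positivity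

lemma cutFract_le_one (hK : 0 < K) (k : ℕ) : cutFract K L k ≤ 1 := by
  rw [cutFract, div_le_one (by exact_mod_cast hK)]
  exact_mod_cast (Nat.mod_lt _ hK).le

lemma cut_add_cutFract (hK : 0 < K) (k : ℕ) :
    (cut K L k : ℝ) + cutFract K L k = k * (L / K : ℝ) := by
  have hK' : (K : ℝ) ≠ 0 := by exact_mod_cast hK.ne'
  have h : (K : ℝ) * cut K L k + (k * L % K : ℕ) = k * L := by
    exact_mod_cast Nat.div_add_mod (k * L) K
  rw [cutFract]
  field_simp
  linarith

/-- The squared entries as a sum of indicators of disjoint ranges of `l`. -/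
lemma tetris_sq (hK : 0 < K) (h : 2 * K ≤ L) (l k : ℕ) :
    tetris K L l k ^ 2 =
      (if l = cut K L k then 1 - cutFract K L k / 2 else 0) +
      (if l = cut K L k + 1 then 1 - cutFract K L k / 2 else 0) +
      (if l ∈ Finset.Ico (cut K L k + 2) (cut K L (k + 1)) then 1 else 0) +
      (if l = cut K L (k + 1) then cutFract K L (k + 1) / 2 else 0) +
      (if l = cut K L (k + 1) + 1 then cutFract K L (k + 1) / 2 else 0) := by
  have h1 := cut_add_two_le hK h k
  have h2 : 0 ≤ 1 - cutFract K L k / 2 := by linarith [cutFract_le_one (L := L) hK k]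
  have h3 : 0 ≤ cutFract K L (k + 1) / 2 := by linarith [cutFract_nonneg (K := K) (L := L) (k + 1)]
  unfold tetris
  simp only [Finset.mem_Ico]
  split_ifs <;> first | omega | simp [-Real.sqrt_div', Real.sq_sqrt, h2, h3]

lemma tetris_eq_zero (hK : 0 < K) (h : 2 * K ≤ L) {l k : ℕ}
    (hl : ¬ (cut K L k ≤ l ∧ l < cut K L (k + 1) + 2)) : tetris K L l k = 0 := by
  have h1 := cut_add_two_le hK h k
  unfold tetris
  split_ifs <;> first | omega | rfl

lemma sum_tetris_sq_row (hK : 0 < K) (h : 2 * K ≤ L) {k : ℕ} (hk : k < K) :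
    ∑ l ∈ Finset.range L, tetris K L l k ^ 2 = (L / K : ℝ) := by
  have h1 := cut_add_two_le hK h k
  have h2 : cut K L (k + 1) ≤ L := cut_le hK hk
  have hsum : ∑ l ∈ Finset.range L, (if l ∈ Finset.Ico (cut K L k + 2) (cut K L (k + 1)) then
      (1 : ℝ) else 0) = cut K L (k + 1) - (cut K L k + 2) := by
    rw [Finset.sum_ite_mem, Finset.inter_eq_right.2, Finset.sum_const, Nat.card_Ico, nsmul_eq_mul,
      Nat.cast_sub h1]
    · push_cast; ring
    · intro l hl
      simp only [Finset.mem_Ico, Finset.mem_range] at *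
      omega
  -- For `k + 1 = K` the two columns lie outside the range, but then the fractional part is zero.
  have hlast : (if cut K L (k + 1) ∈ Finset.range L then cutFract K L (k + 1) / 2 else 0) +
      (if cut K L (k + 1) + 1 ∈ Finset.range L then cutFract K L (k + 1) / 2 else 0) =
      cutFract K L (k + 1) := by
    rcases (show k + 1 ≤ K from hk).eq_or_lt with hk' | hk'
    · rw [hk', cutFract_self]; simp
    · have h3 := cut_add_two_le hK h (k + 1)
      have h4 : cut K L (k + 1 + 1) ≤ L := cut_le hK hk'
      rw [if_pos (by simp; omega), if_pos (by simp; omega)]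
      ring
  simp only [tetris_sq hK h, Finset.sum_add_distrib, hsum, Finset.sum_ite_eq']
  rw [add_assoc, hlast, if_pos (by simp; omega), if_pos (by simp; omega)]
  have e1 := cut_add_cutFract (L := L) hK k
  have e2 := cut_add_cutFract (L := L) hK (k + 1)
  push_cast at e2
  linarith

/-- Distinct rows are orthogonal: they overlap only if they are adjacent, and then in the two columns
of a block `[√(x/2), √(x/2); √(1 - x/2), -√(1 - x/2)]`, whose contributions cancel. -/
lemma sum_tetris_mul_of_lt (hK : 0 < K) (h : 2 * K ≤ L) {k k' : ℕ} (hk : k < k') (hk' : k' < K) :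
    ∑ l ∈ Finset.range L, tetris K L l k * tetris K L l k' = 0 := by
  have h1 := cut_add_two_le hK h k
  have h2 := cut_add_two_le hK h k'
  have hL : cut K L (k' + 1) ≤ L := cut_le hK hk'
  rcases (show k + 1 ≤ k' from hk).eq_or_lt with rfl | hlt
  · have hterm (l : ℕ) : tetris K L l k * tetris K L l (k + 1) =
        (if l = cut K L (k + 1) then
          √(cutFract K L (k + 1) / 2) * √(1 - cutFract K L (k + 1) / 2) else 0) +
        (if l = cut K L (k + 1) + 1 then
          -(√(cutFract K L (k + 1) / 2) * √(1 - cutFract K L (k + 1) / 2)) else 0) := by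
      unfold tetris
      split_ifs <;> first | omega | simp
    simp only [hterm, Finset.sum_add_distrib, Finset.sum_ite_eq']
    rw [if_pos (by simp; omega), if_pos (by simp; omega), add_neg_cancel]
  · refine Finset.sum_eq_zero fun l _ => ?_
    have h3 := cut_add_two_le hK h (k + 1)
    have h4 : cut K L (k + 1 + 1) ≤ cut K L k' := cut_mono hlt
    by_cases hl : l < cut K L (k + 1) + 2
    · rw [tetris_eq_zero hK h (k := k') (by omega), mul_zero]
    · rw [tetris_eq_zero hK h (k := k) (by omega), zero_mul]

lemma sum_tetris_sq_column (hK : 0 < K) (h : 2 * K ≤ L) {l : ℕ} (hl : l < L) :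
    ∑ k ∈ Finset.range K, tetris K L l k ^ 2 = 1 := by
  -- The index `k₀` of the interval between consecutive breakpoints that contains `l`.
  obtain ⟨k₀, hk₀, hk₁⟩ : ∃ k₀, cut K L k₀ ≤ l ∧ l < cut K L (k₀ + 1) := by
    have hex : ∃ k, l < cut K L k := ⟨K, by rwa [cut_self hK]⟩
    have hpos : Nat.find hex ≠ 0 := fun h0 => by
      have := Nat.find_spec hex
      rw [h0, cut_zero] at this
      omega
    refine ⟨Nat.find hex - 1, not_lt.1 (Nat.find_min hex (by omega)), ?_⟩
    rw [Nat.sub_add_cancel (by omega)]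
    exact Nat.find_spec hex
  have hk₀K : k₀ < K := by
    by_contra hcon
    have := cut_mono (K := K) (L := L) (not_lt.1 hcon)
    rw [cut_self hK] at this
    omega
  have hterm (k : ℕ) : tetris K L l k ^ 2 =
      (if k = k₀ then (if l < cut K L k₀ + 2 then 1 - cutFract K L k₀ / 2 else 1) else 0) +
      (if k + 1 = k₀ then (if l < cut K L k₀ + 2 then cutFract K L k₀ / 2 else 0) else 0) := by
    have h1 := cut_add_two_le hK h k
    have h2 := cut_add_two_le hK h (k + 1)
    by_cases hk : k = k₀
    · subst hk
      rw [tetris_sq hK h, if_pos rfl, if_neg (Nat.succ_ne_self k), add_zero,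
        if_neg (show l ≠ cut K L (k + 1) by omega),
        if_neg (show l ≠ cut K L (k + 1) + 1 by omega), add_zero, add_zero]
      simp only [Finset.mem_Ico]
      split_ifs <;> first | omega | simp
    by_cases hk' : k + 1 = k₀
    · subst hk'
      rw [tetris_sq hK h, if_neg hk, if_pos rfl, zero_add,
        if_neg (show l ≠ cut K L k by omega), if_neg (show l ≠ cut K L k + 1 by omega),
        if_neg (by simp; omega), zero_add, zero_add, zero_add]
      split_ifs <;> first | omega | simp
    rw [if_neg hk, if_neg hk', tetris_eq_zero hK h]
    · simp
    · rcases lt_or_gt_of_ne hk with hlt | hgt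
      · have := cut_mono (K := K) (L := L) (show k + 1 + 1 ≤ k₀ by omega)
        omega
      · have := cut_mono (K := K) (L := L) (show k₀ + 1 ≤ k from hgt)
        omega
  simp only [hterm, Finset.sum_add_distrib, Finset.sum_ite_eq']
  rw [if_pos (Finset.mem_range.2 hk₀K)]
  rcases k₀ with _ | j
  · simp [cutFract_zero]
  · simp only [add_left_inj, Finset.sum_ite_eq']
    rw [if_pos (Finset.mem_range.2 (by omega : j < K))]
    split_ifs <;> ring

lemma exists_sparse_frame (hK : 0 < K) (h : 3 * K ≤ L) :
    ∃ B : Matrix (Fin L) (Fin K) ℂ, Bᴴ * B = 1 ∧ muMaxSq B = 1 ∧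
      ∃ S : Fin K → Finset (Fin L), (∀ k, (S k).Nonempty) ∧
        (∀ k, ((S k).card : ℝ) ≤ 2 * (L / K : ℝ)) ∧ (∀ k l, l ∉ S k → bVec B l k = 0) ∧
        ∃ J : Finset (Fin K), K ≤ 2 * J.card ∧ (J : Set (Fin K)).PairwiseDisjoint S := by
  have h2 : 2 * K ≤ L := by omega
  have hKR : (0 : ℝ) < K := by exact_mod_cast hK
  have hLR : (0 : ℝ) < L := by exact_mod_cast (by omega : 0 < L)
  let V : Matrix (Fin L) (Fin K) ℂ := Matrix.of fun l k => ((√(K / L : ℝ) * tetris K L l k : ℝ) : ℂ)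
  have hF := dftMatrix_mem_unitaryGroup L
  have hFB : dftMatrix L * ((dftMatrix L)ᴴ * V) = V := by
    rw [← Matrix.mul_assoc, ← Matrix.star_eq_conjTranspose, Matrix.mem_unitaryGroup_iff.1 hF,
      Matrix.one_mul]
  have hb (l : Fin L) (k : Fin K) : bVec ((dftMatrix L)ᴴ * V) l k =
      ((√(K / L : ℝ) * tetris K L l k : ℝ) : ℂ) := by
    simp only [bVec, hFB, V, Matrix.of_apply, Complex.star_def, Complex.conj_ofReal]
  have hsq : √(K / L : ℝ) * √(K / L : ℝ) = K / L := Real.mul_self_sqrt (by positivity)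
  refine ⟨(dftMatrix L)ᴴ * V, ?_, ?_, ?_⟩
  · rw [Matrix.conjTranspose_mul, Matrix.conjTranspose_conjTranspose, Matrix.mul_assoc, hFB]
    ext k k'
    have hsum : (Vᴴ * V) k k' = ((K / L * ∑ l ∈ Finset.range L,
        tetris K L l k * tetris K L l k' : ℝ) : ℂ) := by
      rw [← Fin.sum_univ_eq_sum_range fun l => tetris K L l k * tetris K L l k', Matrix.mul_apply,
        Finset.mul_sum, Complex.ofReal_sum]
      refine Finset.sum_congr rfl fun l _ => ?_
      simp only [V, Matrix.conjTranspose_apply, Matrix.of_apply, Complex.star_def,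
        Complex.conj_ofReal, ← Complex.ofReal_mul]
      congr 1
      linear_combination (tetris K L l k * tetris K L l k') * hsq
    rw [hsum]
    rcases lt_trichotomy k k' with hlt | rfl | hgt
    · rw [sum_tetris_mul_of_lt hK h2 hlt k'.2, Matrix.one_apply_ne hlt.ne]
      simp
    · have : ∑ l ∈ Finset.range L, tetris K L l k * tetris K L l k = (L / K : ℝ) := by
        simpa only [sq] using sum_tetris_sq_row hK h2 k.2
      rw [this, Matrix.one_apply_eq, div_mul_div_cancel₀ hLR.ne', div_self hKR.ne',
        Complex.ofReal_one]
    · rw [Matrix.one_apply_ne hgt.ne']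
      simp only [mul_comm (tetris K L _ k)]
      rw [sum_tetris_mul_of_lt hK h2 hgt k.2]
      simp
  · have hn (l : Fin L) : ‖bVec ((dftMatrix L)ᴴ * V) l‖ ^ 2 = K / L := by
      rw [EuclideanSpace.norm_sq_eq]
      simp only [hb, Complex.norm_real, Real.norm_eq_abs, sq_abs, mul_pow]
      rw [← Finset.mul_sum, Fin.sum_univ_eq_sum_range fun k => tetris K L l k ^ 2,
        sum_tetris_sq_column hK h2 l.2, sq, hsq, mul_one]
    have : Nonempty (Fin L) := ⟨⟨0, by omega⟩⟩
    simp only [muMaxSq, hn, ciSup_const]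
    field_simp
  · refine ⟨fun k => Finset.univ.filter fun l =>
      cut K L k ≤ (l : ℕ) ∧ (l : ℕ) < cut K L (k + 1) + 2, fun k => ?_, fun k => ?_,
      fun k l hl => ?_, ?_⟩
    · have h3 := cut_add_two_le hK h2 k
      have h4 : cut K L (k + 1) ≤ L := cut_le hK k.2
      exact ⟨⟨cut K L k, by omega⟩, by simp; omega⟩
    · have hcard : (Finset.univ.filter fun l : Fin L =>
          cut K L k ≤ (l : ℕ) ∧ (l : ℕ) < cut K L (k + 1) + 2).card ≤
          cut K L (k + 1) + 2 - cut K L k := by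
        rw [← Nat.card_Ico]
        refine Finset.card_le_card_of_injOn (fun l => (l : ℕ)) (fun l hl => ?_)
          Fin.val_injective.injOn
        simpa using hl
      have h3 := cut_add_two_le hK h2 k
      have hcard' : ((Finset.univ.filter fun l : Fin L =>
          cut K L k ≤ (l : ℕ) ∧ (l : ℕ) < cut K L (k + 1) + 2).card : ℝ) + cut K L k ≤
          cut K L (k + 1) + 2 := by
        exact_mod_cast (by omega)
      have e1 := cut_add_cutFract (L := L) hK k
      have e2 := cut_add_cutFract (L := L) hK (k + 1)
      have e3 := cutFract_nonneg (K := K) (L := L) (k + 1)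
      have e4 := cutFract_le_one (L := L) hK k
      have e5 : (3 : ℝ) ≤ L / K := by
        rw [le_div_iff₀ hKR]
        exact_mod_cast h
      push_cast at e2
      linarith
    · rw [hb, tetris_eq_zero hK h2 (by simpa using hl)]
      simp
    · refine ⟨Finset.univ.image fun j : Fin ((K + 1) / 2) => (⟨2 * j, by omega⟩ : Fin K), ?_, ?_⟩
      · rw [Finset.card_image_of_injective _ fun a b hab => ?_]
        · simp; omega
        · simpa [Fin.ext_iff] using hab
      · have hlt (i j : ℕ) (hij : i < j) : cut K L (2 * i + 1) + 2 ≤ cut K L (2 * j) :=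
          (cut_add_two_le hK h2 _).trans (cut_mono (by omega))
        intro a ha b hb' hab
        simp only [Finset.coe_image, Finset.coe_univ, Set.image_univ, Set.mem_range] at ha hb'
        obtain ⟨i, rfl⟩ := ha
        obtain ⟨j, rfl⟩ := hb'
        have hij : (i : ℕ) ≠ j := fun h' => hab (by simp [h'])
        refine Finset.disjoint_left.2 fun l hl hl' => ?_
        simp only [Finset.mem_filter, Finset.mem_univ, true_and] at hl hl'
        rcases lt_or_gt_of_ne hij with h' | h'
        · have := hlt _ _ h'; omega
        · have := hlt _ _ h'; omega

end Frame

/-! ### Distance to the span of a finite family -/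

section DistSpan

variable {E : Type*} [NormedAddCommGroup E] [InnerProductSpace ℂ E] {σ : Type*} [Fintype σ]

/-- Distance of `y` to the linear span of the finite family `c`, as an infimum over coefficients. -/
noncomputable def distSpan (y : E) (c : σ → E) : ℝ :=
  ⨅ a : σ → ℂ, ‖y - ∑ l, a l • c l‖

/-- An infimum of continuous functions is upper semicontinuous. -/
lemma measurable_distSpan [MeasurableSpace E] [BorelSpace E] [SecondCountableTopology E] (y : E) :
    Measurable fun c : σ → E => distSpan y c := by
  refine UpperSemicontinuous.measurable (upperSemicontinuous_ciInf (fun c => ?_) fun a => ?_)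
  · exact ⟨0, by rintro _ ⟨a, rfl⟩; exact norm_nonneg _⟩
  · apply Continuous.upperSemicontinuous
    fun_prop

lemma distSpan_map {E' : Type*} [NormedAddCommGroup E'] [InnerProductSpace ℂ E'] (e : E ≃ₗᵢ[ℂ] E')
    (y : E) (c : σ → E) : distSpan (e y) (fun l => e (c l)) = distSpan y c := by
  unfold distSpan
  refine iInf_congr fun a => ?_
  rw [← e.norm_map (y - _)]
  simp

lemma distSpan_eq_norm_sub_starProjection [FiniteDimensional ℂ E] (y : E) (c : σ → E) :
    distSpan y c = ‖y - (Submodule.span ℂ (Set.range c)).starProjection y‖ := by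
  rw [Submodule.starProjection_minimal]
  let f : (σ → ℂ) → Submodule.span ℂ (Set.range c) := fun a =>
    ⟨∑ l, a l • c l, (Submodule.mem_span_range_iff_exists_fun ℂ).2 ⟨a, rfl⟩⟩
  have hf : Function.Surjective f := by
    rintro ⟨x, hx⟩
    obtain ⟨a, ha⟩ := (Submodule.mem_span_range_iff_exists_fun ℂ).1 hx
    exact ⟨a, Subtype.ext ha⟩
  exact hf.iInf_comp fun x : Submodule.span ℂ (Set.range c) => ‖y - x‖

lemma norm_starProjection_sq_eq [FiniteDimensional ℂ E] (y : E) (c : σ → E) :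
    ‖(Submodule.span ℂ (Set.range c)).starProjection y‖ ^ 2 = ‖y‖ ^ 2 - distSpan y c ^ 2 := by
  rw [distSpan_eq_norm_sub_starProjection]
  have h := Submodule.norm_sq_eq_add_norm_sq_starProjection y (Submodule.span ℂ (Set.range c))
  rw [Submodule.starProjection_orthogonal_val] at h
  linarith

/-- The trace of an orthogonal projection is its rank. -/
lemma sum_norm_starProjection_sq {ι : Type*} [Fintype ι] (e : OrthonormalBasis ι ℂ E)
    (V : Submodule ℂ E) [FiniteDimensional ℂ V] :
    ∑ n, ‖V.starProjection (e n)‖ ^ 2 = Module.finrank ℂ V := by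
  let f := stdOrthonormalBasis ℂ V
  have h (n : ι) : ‖V.starProjection (e n)‖ ^ 2 = ∑ k, ‖inner ℂ (f k : E) (e n)‖ ^ 2 := by
    rw [Submodule.starProjection_apply, ← Submodule.coe_norm, ← f.sum_sq_norm_inner_right]
    refine Finset.sum_congr rfl fun k _ => ?_
    rw [Submodule.coe_inner, ← Submodule.starProjection_apply, ← Submodule.inner_starProjection_left_eq_right,
      Submodule.starProjection_eq_self_iff.2 (f k).2]
  simp_rw [h]
  rw [Finset.sum_comm]
  have h2 (k) : ∑ n, ‖inner ℂ (f k : E) (e n)‖ ^ 2 = 1 := by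
    rw [e.sum_sq_norm_inner_left, ← Submodule.coe_norm, f.orthonormal.1 k, one_pow]
  simp [h2]

lemma sum_one_sub_distSpan_sq_le [FiniteDimensional ℂ E] {ι : Type*} [Fintype ι] (e : OrthonormalBasis ι ℂ E) (c : σ → E) :
    ∑ n, (1 - distSpan (e n) c ^ 2) ≤ (Fintype.card σ : ℝ) := by
  have h (n : ι) := norm_starProjection_sq_eq (e n) c
  simp_rw [e.orthonormal.1, one_pow] at h
  simp_rw [← h, sum_norm_starProjection_sq]
  exact_mod_cast finrank_range_le_card c

end DistSpan

/-! ### Independence over disjoint blocks -/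

/-- Events depending on pairwise disjoint blocks of independent σ-algebras are independent. -/
lemma measure_biInter_eq_prod_of_disjoint {Ω ι κ : Type*} {m0 : MeasurableSpace Ω} {μ : Measure Ω}
    {m : ι → MeasurableSpace Ω} (hle : ∀ i, m i ≤ m0) (hm : iIndep m μ) (T : κ → Set ι)
    (A : κ → Set Ω) (hA : ∀ k, MeasurableSet[⨆ i ∈ T k, m i] (A k)) (J : Finset κ)
    (hT : (J : Set κ).PairwiseDisjoint T) :
    μ (⋂ k ∈ J, A k) = ∏ k ∈ J, μ (A k) := by
  classical
  have := hm.isProbabilityMeasure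
  induction J using Finset.induction_on with
  | empty => simp
  | insert j J hj ih =>
    rw [Finset.prod_insert hj, ← ih (hT.subset (by simp)), Finset.set_biInter_insert]
    have hdisj : Disjoint (T j) (⋃ k ∈ J, T k) := by
      rw [Set.disjoint_iUnion₂_right]
      intro k hk
      exact hT (by simp) (by simp [hk]) (fun h => hj (h ▸ hk))
    refine (Indep_iff _ _ μ).1 (indep_iSup_of_disjoint hle hm hdisj) _ _ (hA j) ?_
    refine Finset.measurableSet_biInter J fun k hk => ?_
    refine (iSup₂_le fun i hi => ?_ : (⨆ i ∈ T k, m i) ≤ _) _ (hA k)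
    exact le_iSup₂_of_le i (Set.mem_biUnion hk hi) le_rfl

/-! ### The complex Gaussian distribution -/

lemma measurable_complex_mk : Measurable (fun p : ℝ × ℝ => (⟨p.1, p.2⟩ : ℂ)) :=
  Complex.measurableEquivRealProd.symm.measurable

instance (v : ℝ≥0) : IsProbabilityMeasure (complexGaussian v) :=
  Measure.isProbabilityMeasure_map measurable_complex_mk.aemeasurable

lemma charFun_complexGaussian (v : ℝ≥0) (t : ℂ) :
    charFun (complexGaussian v) t = Complex.exp (-(v * ‖t‖ ^ 2 / 4 : ℝ)) := by
  have h1 : charFun (complexGaussian v) t =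
      charFun (gaussianReal 0 (v / 2)) t.re * charFun (gaussianReal 0 (v / 2)) t.im := by
    rw [charFun_apply, complexGaussian, integral_map measurable_complex_mk.aemeasurable
      (by fun_prop), charFun_apply_real, charFun_apply_real, ← integral_prod_mul]
    refine integral_congr_ae (Filter.Eventually.of_forall fun p => ?_)
    simp only [Complex.inner, ← Complex.exp_add]
    congr 1
    simp
    ring
  rw [h1, charFun_gaussianReal, charFun_gaussianReal, ← Complex.exp_add]
  congr 1
  rw [Complex.sq_norm, Complex.normSq_apply]
  push_cast
  ring

/-- Unitary invariance of the standard complex Gaussian vector, together with scaling. -/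
lemma map_pi_complexGaussian {ι : Type*} [Fintype ι] [DecidableEq ι] (v c : ℝ≥0)
    {W : Matrix ι ι ℂ} (hW : W ∈ Matrix.unitaryGroup ι ℂ) :
    (Measure.pi fun _ : ι => complexGaussian v).map (fun x i => (c : ℂ) * (W *ᵥ x) i) =
      Measure.pi fun _ : ι => complexGaussian (c ^ 2 * v) := by
  have hmeas : Measurable fun (x : ι → ℂ) i => (c : ℂ) * (W *ᵥ x) i := by
    unfold Matrix.mulVec dotProduct
    fun_prop
  have := Measure.isProbabilityMeasure_map (μ := Measure.pi fun _ : ι => complexGaussian v)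
    hmeas.aemeasurable
  rw [← charFun_eq_pi_iff]
  intro t
  -- The adjoint moves the matrix to the argument of the characteristic function, which depends
  -- on the norm of its argument only.
  have hadj : charFun (((Measure.pi fun _ : ι => complexGaussian v).map
      (fun x i => (c : ℂ) * (W *ᵥ x) i)).map (WithLp.toLp 2)) t =
      charFun ((Measure.pi fun _ : ι => complexGaussian v).map (WithLp.toLp 2))
        (WithLp.toLp 2 fun i => (c : ℂ) * (Wᴴ *ᵥ t.ofLp) i) := by
    rw [Measure.map_map (by fun_prop) hmeas, charFun_apply, charFun_apply,
      integral_map (by fun_prop) (by fun_prop), integral_map (by fun_prop) (by fun_prop)]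
    refine integral_congr_ae (Filter.Eventually.of_forall fun x => ?_)
    have : inner ℝ (WithLp.toLp 2 fun i => (c : ℂ) * (W *ᵥ x) i : PiLp 2 fun _ : ι => ℂ) t =
        inner ℝ (WithLp.toLp 2 x : PiLp 2 fun _ : ι => ℂ)
          (WithLp.toLp 2 fun i => (c : ℂ) * (Wᴴ *ᵥ t.ofLp) i) := by
      simp only [PiLp.inner_apply, Complex.inner]
      rw [← Complex.re_sum, ← Complex.re_sum]
      congr 1
      have e1 : ∑ i, (starRingEnd ℂ) ((c : ℂ) * (W *ᵥ x) i) * t.ofLp i =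
          (c : ℂ) * (star (W *ᵥ x) ⬝ᵥ t.ofLp) := by
        simp [dotProduct, Finset.mul_sum, mul_assoc]
      have e2 : ∑ i, (starRingEnd ℂ) (x i) * ((c : ℂ) * (Wᴴ *ᵥ t.ofLp) i) =
          (c : ℂ) * (star x ⬝ᵥ (Wᴴ *ᵥ t.ofLp)) := by
        simp only [dotProduct, Finset.mul_sum]
        refine Finset.sum_congr rfl fun i _ => ?_
        simp [mul_left_comm]
      simp only [mul_comm _ ((starRingEnd ℂ) _)]
      rw [e1, e2, Matrix.star_mulVec, Matrix.dotProduct_mulVec]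
    simp only [Function.comp]
    rw [this]
  rw [hadj, charFun_pi]
  simp only [charFun_complexGaussian, ← Complex.exp_sum]
  congr 1
  have hnorm : ∑ i, ‖(Wᴴ *ᵥ t.ofLp) i‖ ^ 2 = ∑ i, ‖t.ofLp i‖ ^ 2 := by
    have key (s : ι → ℂ) : ((∑ i, ‖s i‖ ^ 2 : ℝ) : ℂ) = star s ⬝ᵥ s := by
      simp [dotProduct, Complex.conj_mul']
    have : star (Wᴴ *ᵥ t.ofLp) ⬝ᵥ (Wᴴ *ᵥ t.ofLp) = star t.ofLp ⬝ᵥ t.ofLp := by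
      rw [Matrix.star_mulVec, Matrix.conjTranspose_conjTranspose, Matrix.dotProduct_mulVec,
        Matrix.vecMul_vecMul, ← Matrix.star_eq_conjTranspose, Matrix.mem_unitaryGroup_iff.1 hW,
        Matrix.vecMul_one]
    exact_mod_cast (key _).trans (this.trans (key _).symm)
  rw [Finset.sum_neg_distrib, Finset.sum_neg_distrib, neg_inj]
  norm_cast
  simp only [norm_mul, mul_pow, ← Finset.sum_div]
  congr 1
  rw [← Finset.mul_sum, ← Finset.mul_sum, ← Finset.mul_sum, hnorm]
  simp
  ring

lemma integrable_exp_mul_sq_gaussianReal {s : ℝ} (hs : s < 1) :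
    Integrable (fun x => Real.exp (s * x ^ 2)) (gaussianReal 0 (1 / 2)) ∧
      ∫ x, Real.exp (s * x ^ 2) ∂gaussianReal 0 (1 / 2) = (√(1 - s))⁻¹ := by
  have hv : (1 / 2 : ℝ≥0) ≠ 0 := by norm_num
  have hpdf (x : ℝ) : gaussianPDFReal 0 (1 / 2) x * Real.exp (s * x ^ 2) =
      (√Real.pi)⁻¹ * Real.exp (-(1 - s) * x ^ 2) := by
    rw [gaussianPDFReal, mul_assoc, ← Real.exp_add]
    congr 2
    · have h2 : 2 * Real.pi * ((1 / 2 : ℝ≥0) : ℝ) = Real.pi := by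
        push_cast
        ring
      rw [h2]
    · push_cast
      ring
  constructor
  · rw [gaussianReal_of_var_ne_zero _ hv, integrable_withDensity_iff_integrable_smul'
      (measurable_gaussianPDF _ _) (Filter.Eventually.of_forall fun _ => gaussianPDF_lt_top)]
    simp only [toReal_gaussianPDF, smul_eq_mul, hpdf]
    exact (integrable_exp_neg_mul_sq (by linarith)).const_mul _
  · rw [integral_gaussianReal_eq_integral_smul hv]
    simp only [smul_eq_mul, hpdf]
    rw [integral_const_mul, integral_gaussian, Real.sqrt_div Real.pi_pos.le]
    have : √Real.pi ≠ 0 := by positivity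
    field_simp

lemma integrable_exp_mul_normSq_complexGaussian {s : ℝ} (hs : s < 1) :
    Integrable (fun z => Real.exp (s * ‖z‖ ^ 2)) (complexGaussian 1) ∧
      ∫ z, Real.exp (s * ‖z‖ ^ 2) ∂complexGaussian 1 = (1 - s)⁻¹ := by
  obtain ⟨h1, h2⟩ := integrable_exp_mul_sq_gaussianReal hs
  have hp (p : ℝ × ℝ) : Real.exp (s * ‖(⟨p.1, p.2⟩ : ℂ)‖ ^ 2) =
      Real.exp (s * p.1 ^ 2) * Real.exp (s * p.2 ^ 2) := by
    rw [← Real.exp_add, Complex.sq_norm, Complex.normSq_mk]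
    congr 1
    ring
  constructor
  · rw [complexGaussian, integrable_map_measure (by fun_prop) measurable_complex_mk.aemeasurable]
    simp only [Function.comp_def, hp]
    exact h1.mul_prod h1
  · rw [complexGaussian, integral_map measurable_complex_mk.aemeasurable (by fun_prop)]
    simp only [hp]
    rw [integral_prod_mul (fun x => Real.exp (s * x ^ 2)) fun x => Real.exp (s * x ^ 2), h2,
      ← mul_inv, Real.mul_self_sqrt (by linarith)]

/-! ### Chernoff bound for weighted sums of squared moduli -/

lemma inv_one_sub_le_exp {s : ℝ} (h0 : 0 ≤ s) (h1 : s ≤ 1 / 2) : (1 - s)⁻¹ ≤ Real.exp (2 * s) := by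
  have h2 : (1 - s)⁻¹ ≤ 1 + 2 * s := by
    rw [inv_le_iff_one_le_mul₀ (by linarith)]
    nlinarith
  linarith [Real.add_one_le_exp (2 * s)]

/-- A convex combination of squared moduli of independent standard complex Gaussians, with weights
at most `M`, is at least `4` with probability at most `exp (-1 / M)`. -/
lemma measureReal_four_le_sum_mul_normSq {L N : ℕ} (n : Fin N) (w : Fin L → ℝ) (hw : ∀ l, 0 ≤ w l)
    (hsum : ∑ l, w l = 1) {M : ℝ} (hM : 0 < M) (hwM : ∀ l, w l ≤ M) :
    (Measure.pi fun _ : Fin L × Fin N => complexGaussian 1).real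
      {g | 4 ≤ ∑ l, w l * ‖g (l, n)‖ ^ 2} ≤ Real.exp (-(1 / M)) := by
  set μ := Measure.pi fun _ : Fin L × Fin N => complexGaussian 1
  -- The Chernoff parameter is chosen such that `s * w l ≤ 1 / 2`.
  set s : ℝ := 1 / (2 * M) with hs
  have hs0 : 0 ≤ s := by positivity
  have hsw (l) : s * w l ≤ 1 / 2 := by
    rw [hs, one_div, inv_mul_le_iff₀ (by positivity)]
    linarith [hwM l]
  let X : Fin L → (Fin L × Fin N → ℂ) → ℝ := fun l g => w l * ‖g (l, n)‖ ^ 2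
  have hXm (l) : Measurable (X l) := by fun_prop
  have hind : iIndepFun X μ := by
    have h1 : iIndepFun (fun (p : Fin L × Fin N) (g : Fin L × Fin N → ℂ) => g p) μ :=
      iIndepFun_pi (X := fun _ => id) fun _ => aemeasurable_id
    have h2 := h1.precomp (g := fun l : Fin L => (l, n)) fun a b h => by simpa using h
    exact h2.comp (fun l z => w l * ‖z‖ ^ 2) fun l => by fun_prop
  have hev (l) : MeasurePreserving (fun g : Fin L × Fin N → ℂ => g (l, n)) μ (complexGaussian 1) :=
    measurePreserving_eval (fun _ : Fin L × Fin N => complexGaussian 1) (l, n)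
  have hint (l) : Integrable (fun g => Real.exp (s * X l g)) μ := by
    have := (hev l).integrable_comp_of_integrable
      (integrable_exp_mul_normSq_complexGaussian (s := s * w l) (by linarith [hsw l])).1
    simpa [Function.comp_def, X, mul_assoc] using this
  have hmgf (l) : mgf (X l) μ s ≤ Real.exp (2 * (s * w l)) := by
    refine le_trans (le_of_eq ?_) (inv_one_sub_le_exp (mul_nonneg hs0 (hw l)) (hsw l))
    rw [← (integrable_exp_mul_normSq_complexGaussian (s := s * w l) (by linarith [hsw l])).2,
      ← (hev l).map_eq, integral_map (hev l).measurable.aemeasurable (by fun_prop)]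
    simp [mgf, X, mul_assoc]
  have hch := measure_ge_le_exp_mul_mgf (μ := μ) (X := ∑ l, X l) 4 hs0
    (hind.integrable_exp_mul_sum hXm fun l _ => hint l)
  rw [hind.mgf_sum hXm] at hch
  simp only [Finset.sum_apply, X] at hch
  refine hch.trans ?_
  calc _ ≤ Real.exp (-s * 4) * ∏ l, Real.exp (2 * (s * w l)) := by
        gcongr with l _
        · exact fun l _ => mgf_nonneg
        · exact hmgf l
    _ = Real.exp (-(1 / M)) := by
        rw [← Real.exp_sum, ← Real.exp_add, ← Finset.mul_sum, ← Finset.mul_sum, hsum, hs]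
        congr 1
        field_simp
        ring

/-! ### Projection onto the span of Gaussian rows -/

section RandomSpan

/-- The `l`-th row of an array `g`, as a vector in Euclidean space. -/
def row {L N : ℕ} (g : Fin L × Fin N → ℂ) (l : Fin L) : EuclideanSpace ℂ (Fin N) :=
  WithLp.toLp 2 fun n => g (l, n)

/-- Squared norm of the orthogonal projection of the `n`-th standard basis vector onto the span of
the rows of `g` indexed by `S`. -/
noncomputable def projSq {L N : ℕ} (S : Finset (Fin L)) (n : Fin N) (g : Fin L × Fin N → ℂ) : ℝ :=
  1 - distSpan (EuclideanSpace.basisFun (Fin N) ℂ n) (fun l : S => row g l) ^ 2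

variable {L N : ℕ}

lemma projSq_eq (S : Finset (Fin L)) (n : Fin N) (g : Fin L × Fin N → ℂ) :
    projSq S n g = ‖(Submodule.span ℂ (Set.range fun l : S => row g l)).starProjection
      (EuclideanSpace.basisFun (Fin N) ℂ n)‖ ^ 2 := by
  rw [norm_starProjection_sq_eq, (EuclideanSpace.basisFun (Fin N) ℂ).orthonormal.1, one_pow, projSq]

/-- The projection depends measurably on the rows indexed by `S` alone. -/
lemma measurable_projSq_comp {Ω : Type*} [MeasurableSpace Ω] (S : Finset (Fin L)) (n : Fin N)
    {X : Ω → Fin L × Fin N → ℂ} (hX : ∀ p, p.1 ∈ S → Measurable fun ω => X ω p) :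
    Measurable fun ω => projSq S n (X ω) := by
  refine (((measurable_distSpan (σ := S) _).pow_const 2).const_sub 1).comp ?_
  exact measurable_pi_lambda _ fun l => (WithLp.measurable_toLp 2 _).comp
    (measurable_pi_lambda _ fun k => hX (l, k) l.2)

lemma measurable_projSq_iSup (S : Finset (Fin L)) (n : Fin N) :
    Measurable[⨆ p ∈ {p : Fin L × Fin N | p.1 ∈ S},
      MeasurableSpace.comap (fun g : Fin L × Fin N → ℂ => g p) inferInstance] (projSq S n) :=
  @measurable_projSq_comp L N _ (_) S n id fun p hp =>
    Measurable.mono (comap_measurable fun g : Fin L × Fin N → ℂ => g p)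
      (le_iSup₂_of_le p hp le_rfl) le_rfl

lemma measurable_projSq (S : Finset (Fin L)) (n : Fin N) : Measurable (projSq (L := L) S n) :=
  measurable_projSq_comp S n fun p _ => measurable_pi_apply p

/-- Permuting the columns of `g` and the standard basis simultaneously does not change the
projection. -/
lemma projSq_comp_perm (S : Finset (Fin L)) (n : Fin N) (τ : Equiv.Perm (Fin N))
    (g : Fin L × Fin N → ℂ) :
    projSq S (τ n) (fun p => g (p.1, τ.symm p.2)) = projSq S n g := by
  unfold projSq
  rw [← distSpan_map (LinearIsometryEquiv.piLpCongrLeft 2 ℂ ℂ τ)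
    (EuclideanSpace.basisFun (Fin N) ℂ n)]
  congr 3
  simp

/-- The columns of a Gaussian array are exchangeable. -/
lemma integral_projSq_eq (S : Finset (Fin L)) (n n' : Fin N) :
    ∫ g, projSq S n g ∂(Measure.pi fun _ : Fin L × Fin N => complexGaussian 1) =
      ∫ g, projSq S n' g ∂(Measure.pi fun _ : Fin L × Fin N => complexGaussian 1) := by
  let τ : Equiv.Perm (Fin N) := Equiv.swap n n'
  have hmp := measurePreserving_piCongrLeft (fun _ : Fin L × Fin N => complexGaussian 1)
    (Equiv.prodCongr (Equiv.refl (Fin L)) τ)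
  rw [← hmp.integral_comp' (g := projSq S n')]
  refine integral_congr_ae (Filter.Eventually.of_forall fun g => ?_)
  have h := projSq_comp_perm S n τ g
  simp only [τ, Equiv.swap_apply_left] at h
  refine h.symm.trans (congrArg _ (funext fun p => ?_))
  obtain ⟨q, rfl⟩ := (Equiv.prodCongr (Equiv.refl (Fin L)) τ).surjective p
  rw [MeasurableEquiv.piCongrLeft_apply_apply]
  simp [τ]

lemma projSq_mem_Icc (S : Finset (Fin L)) (n : Fin N) (g : Fin L × Fin N → ℂ) :
    projSq S n g ∈ Set.Icc (0 : ℝ) 1 :=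
  ⟨by rw [projSq_eq]; positivity, by unfold projSq; linarith [sq_nonneg (distSpan
    (EuclideanSpace.basisFun (Fin N) ℂ n) (fun l : S => row g l))]⟩

lemma integral_projSq_le (S : Finset (Fin L)) (n : Fin N) :
    ∫ g, projSq S n g ∂(Measure.pi fun _ : Fin L × Fin N => complexGaussian 1) ≤ S.card / N := by
  have hN : (0 : ℝ) < N := by exact_mod_cast n.pos
  have hint (k : Fin N) : Integrable (projSq S k)
      (Measure.pi fun _ : Fin L × Fin N => complexGaussian 1) :=
    Integrable.of_mem_Icc 0 1 (measurable_projSq S k).aemeasurable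
      (Filter.Eventually.of_forall (projSq_mem_Icc S k))
  have h1 : ∑ k : Fin N, ∫ g, projSq S k g ∂(Measure.pi fun _ : Fin L × Fin N => complexGaussian 1)
      ≤ S.card := by
    rw [← integral_finsetSum _ fun k _ => hint k]
    refine (integral_mono (integrable_finsetSum _ fun k _ => hint k) (integrable_const (S.card : ℝ))
      fun g => ?_).trans (by simp)
    have := sum_one_sub_distSpan_sq_le (EuclideanSpace.basisFun (Fin N) ℂ) (fun l : S => row g l)
    rw [Fintype.card_coe] at this
    exact this
  rw [Finset.sum_congr rfl fun k _ => integral_projSq_eq S k n] at h1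
  rw [le_div_iff₀ hN]
  simpa [mul_comm] using h1

/-- Markov's inequality for the squared norm of the projection. -/
lemma measureReal_two_mul_le_projSq {S : Finset (Fin L)} (hS : S.Nonempty) (n : Fin N) :
    (Measure.pi fun _ : Fin L × Fin N => complexGaussian 1).real
      {g | 2 * (S.card / N : ℝ) ≤ projSq S n g} ≤ 1 / 2 := by
  have hN : (0 : ℝ) < N := by exact_mod_cast n.pos
  have hc : (0 : ℝ) < S.card / N := div_pos (by exact_mod_cast hS.card_pos) hN
  have h := mul_meas_ge_le_integral_of_nonneg (μ := Measure.pi fun _ : Fin L × Fin N =>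
    complexGaussian 1) (f := projSq S n) (Filter.Eventually.of_forall fun g =>
      (projSq_mem_Icc S n g).1) (Integrable.of_mem_Icc 0 1 (measurable_projSq S n).aemeasurable
      (Filter.Eventually.of_forall (projSq_mem_Icc S n))) (2 * (S.card / N : ℝ))
  have h2 := h.trans (integral_projSq_le S n)
  nlinarith

/-- For disjoint sets of rows the projections are independent, so that the probabilities multiply. -/
lemma measureReal_forall_two_mul_le_projSq {κ : Type*} (J : Finset κ) (S : κ → Finset (Fin L))
    (hS : ∀ k, (S k).Nonempty) (hdisj : (J : Set κ).PairwiseDisjoint S) (n : Fin N) :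
    (Measure.pi fun _ : Fin L × Fin N => complexGaussian 1).real
      {g | ∀ k ∈ J, 2 * ((S k).card / N : ℝ) ≤ projSq (S k) n g} ≤ (1 / 2) ^ J.card := by
  have hind : iIndep (fun p : Fin L × Fin N =>
      MeasurableSpace.comap (fun g : Fin L × Fin N → ℂ => g p) inferInstance)
      (Measure.pi fun _ : Fin L × Fin N => complexGaussian 1) :=
    iIndepFun_pi (X := fun _ => id) fun _ => aemeasurable_id
  have h := measure_biInter_eq_prod_of_disjoint (fun p => (measurable_pi_apply p).comap_le) hind
    (fun k => {p | p.1 ∈ S k}) (fun k => {g | 2 * ((S k).card / N : ℝ) ≤ projSq (S k) n g})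
    (fun k => (measurable_projSq_iSup (S k) n) measurableSet_Ici) J
    (fun i hi j hj hij => Set.disjoint_left.2 fun p h1 h2 =>
      Finset.disjoint_left.1 (hdisj hi hj hij) h1 h2)
  have hset : {g | ∀ k ∈ J, 2 * ((S k).card / N : ℝ) ≤ projSq (S k) n g} =
      ⋂ k ∈ J, {g | 2 * ((S k).card / N : ℝ) ≤ projSq (S k) n g} := by
    ext; simp
  rw [hset, measureReal_def, h, ENNReal.toReal_prod, ← Finset.prod_const]
  exact Finset.prod_le_prod (fun _ _ => ENNReal.toReal_nonneg) fun k _ =>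
    measureReal_two_mul_le_projSq (hS k) n

end RandomSpan

/-! ### Gaussian coordinates, coherence and the final estimate -/

section Assembly

variable {L K N : ℕ}

/-- In any orthonormal basis the coordinates of the vectors `c_ℓ` are independent standard complex
Gaussians: they arise from the entries of `√L C` through the Kronecker product of two unitary
matrices. -/
lemma map_inner_cVec {Ω : Type*} [MeasurableSpace Ω] {P : Measure Ω} [IsProbabilityMeasure P]
    {C : Ω → Matrix (Fin L) (Fin N) ℂ} (hC : IsGaussianMatrix P C) (hL : L ≠ 0)
    (u : OrthonormalBasis (Fin N) ℂ (EuclideanSpace ℂ (Fin N))) :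
    P.map (fun ω (p : Fin L × Fin N) => inner ℂ (u p.2) (cVec (C ω) p.1)) =
      Measure.pi fun _ => complexGaussian 1 := by
  let V : Matrix (Fin N) (Fin N) ℂ := Matrix.of fun n j => star (u n j)
  have hV : V ∈ Matrix.unitaryGroup (Fin N) ℂ := by
    rw [Matrix.mem_unitaryGroup_iff]
    ext n n'
    have h := orthonormal_iff_ite.1 u.orthonormal n n'
    rw [PiLp.inner_apply] at h
    rw [Matrix.mul_apply, Matrix.one_apply, ← h]
    refine Finset.sum_congr rfl fun j _ => ?_
    simp [V, mul_comm]
  have hW := Matrix.kronecker_mem_unitary (dftMatrix_mem_unitaryGroup L) hV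
  have hflat : P.map (fun ω (p : Fin L × Fin N) => C ω p.1 p.2) =
      Measure.pi fun _ => complexGaussian (1 / (L : ℝ≥0)) := by
    have h := (iIndepFun_iff_map_fun_eq_pi_map fun p : Fin L × Fin N =>
      (hC.measurable p.1 p.2).aemeasurable).1 hC.indep
    simpa only [hC.law] using h
  have hflatm : Measurable fun ω (p : Fin L × Fin N) => C ω p.1 p.2 :=
    measurable_pi_lambda _ fun p => hC.measurable p.1 p.2
  have hrot := map_pi_complexGaussian (1 / (L : ℝ≥0)) (NNReal.sqrt L) hW
  have hc : NNReal.sqrt (L : ℝ≥0) ^ 2 * (1 / (L : ℝ≥0)) = 1 := by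
    rw [NNReal.sq_sqrt, mul_one_div_cancel]
    exact_mod_cast hL
  rw [hc, ← hflat, Measure.map_map (by unfold Matrix.mulVec dotProduct; fun_prop) hflatm] at hrot
  rw [← hrot]
  congr 1
  funext ω p
  simp only [Function.comp, Matrix.mulVec, dotProduct, Matrix.kroneckerMap_apply,
    Fintype.sum_prod_type, PiLp.inner_apply, cVec, Matrix.mul_apply, Finset.mul_sum]
  rw [Finset.sum_comm]
  simp only [V, Matrix.of_apply, RCLike.inner_apply, Finset.sum_mul]
  refine Finset.sum_congr rfl fun k _ => Finset.sum_congr rfl fun j _ => ?_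
  simp
  ring

/-- The projection of `m` onto the span of the `c_l`, `l ∈ S`, in the coordinates of a basis one of
whose vectors is `m / ‖m‖`. -/
lemma exists_orthogonal_correction (C : Matrix (Fin L) (Fin N) ℂ)
    (u : OrthonormalBasis (Fin N) ℂ (EuclideanSpace ℂ (Fin N))) (n : Fin N)
    (m : EuclideanSpace ℂ (Fin N)) (hm : m = (‖m‖ : ℂ) • u n) (S : Finset (Fin L)) :
    ∃ v : EuclideanSpace ℂ (Fin N),
      ‖v‖ ^ 2 = projSq S n (fun p => inner ℂ (u p.2) (cVec C p.1)) * ‖m‖ ^ 2 ∧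
      ∀ l ∈ S, inner ℂ (m - v) (cVec C l) = 0 := by
  set g : Fin L × Fin N → ℂ := fun p => inner ℂ (u p.2) (cVec C p.1) with hg
  have hrow (l : Fin L) : u.repr (cVec C l) = row g l := by
    ext k
    simp [row, hg, u.repr_apply_apply]
  set V := Submodule.span ℂ (Set.range fun l : S => row g l)
  set e := EuclideanSpace.basisFun (Fin N) ℂ n
  have hue : u.repr (u n) = e := by simp [e]
  refine ⟨(‖m‖ : ℂ) • u.repr.symm (V.starProjection e), ?_, fun l hl => ?_⟩
  · rw [norm_smul, u.repr.symm.norm_map, projSq_eq, mul_pow, mul_comm]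
    simp [V, e]
  · have h1 : u.repr (m - (‖m‖ : ℂ) • u.repr.symm (V.starProjection e)) =
        (‖m‖ : ℂ) • (e - V.starProjection e) := by
      conv_lhs => rw [hm]
      rw [map_sub, map_smul, map_smul, hue, u.repr.apply_symm_apply, smul_sub]
      simp [norm_smul]
    rw [← u.repr.inner_map_map, h1, hrow, inner_smul_left]
    have h2 : row g l ∈ V := Submodule.subset_span ⟨⟨l, hl⟩, rfl⟩
    rw [Submodule.starProjection_inner_eq_zero e _ h2, mul_zero]

lemma exists_orthonormalBasis_smul_eq (n : Fin N) {m : EuclideanSpace ℂ (Fin N)} (hm : m ≠ 0) :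
    ∃ u : OrthonormalBasis (Fin N) ℂ (EuclideanSpace ℂ (Fin N)), m = (‖m‖ : ℂ) • u n := by
  have hm' : (‖m‖ : ℂ) ≠ 0 := by exact_mod_cast norm_ne_zero_iff.2 hm
  have ho : Orthonormal ℂ (({n} : Set (Fin N)).domRestrict fun _ => (‖m‖ : ℂ)⁻¹ • m) := by
    rw [orthonormal_iff_ite]
    intro i j
    rw [if_pos (Subsingleton.elim i j)]
    have h1 : ‖(‖m‖ : ℂ)⁻¹ • m‖ = 1 := by simp [norm_smul, norm_ne_zero_iff.2 hm]
    simp only [Set.domRestrict_apply, inner_self_eq_norm_sq_to_K, h1]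
    simp
  obtain ⟨u, hu⟩ := ho.exists_orthonormalBasis_extension_of_card_eq (by simp)
  refine ⟨u, ?_⟩
  rw [hu n rfl, smul_smul, mul_inv_cancel₀ hm', one_smul]

/-- The vectors `b_l` form a Parseval frame. -/
lemma sum_norm_inner_bVec_sq {B : Matrix (Fin L) (Fin K) ℂ} (hB : Bᴴ * B = 1)
    (h : EuclideanSpace ℂ (Fin K)) : ∑ l, ‖inner ℂ (bVec B l) h‖ ^ 2 = ‖h‖ ^ 2 := by
  have hinner (l : Fin L) : inner ℂ (bVec B l) h = ((dftMatrix L * B) *ᵥ h.ofLp) l := by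
    simp [bVec, PiLp.inner_apply, Matrix.mulVec, dotProduct, mul_comm]
  have hFB : (dftMatrix L * B)ᴴ * (dftMatrix L * B) = 1 := by
    rw [Matrix.conjTranspose_mul, Matrix.mul_assoc, ← Matrix.mul_assoc _ _ B,
      ← Matrix.star_eq_conjTranspose (dftMatrix L),
      Matrix.mem_unitaryGroup_iff'.1 (dftMatrix_mem_unitaryGroup L), Matrix.one_mul, hB]
  have key {n : ℕ} (s : Fin n → ℂ) : ((∑ i, ‖s i‖ ^ 2 : ℝ) : ℂ) = star s ⬝ᵥ s := by
    simp [dotProduct, Complex.conj_mul']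
  simp only [hinner, EuclideanSpace.norm_sq_eq]
  have : star ((dftMatrix L * B) *ᵥ h.ofLp) ⬝ᵥ ((dftMatrix L * B) *ᵥ h.ofLp) =
      star h.ofLp ⬝ᵥ h.ofLp := by
    rw [Matrix.star_mulVec, Matrix.dotProduct_mulVec, Matrix.vecMul_vecMul, hFB, Matrix.vecMul_one]
  exact_mod_cast (key _).trans (this.trans (key _).symm)

lemma norm_inner_bVec_sq_le_muSq (hL : 0 < L) (B : Matrix (Fin L) (Fin K) ℂ)
    {h : EuclideanSpace ℂ (Fin K)} (hh : h ≠ 0) (l : Fin L) :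
    ‖inner ℂ (bVec B l) h‖ ^ 2 / ‖h‖ ^ 2 ≤ muSq B h / L := by
  have hLR : (0 : ℝ) < L := by exact_mod_cast hL
  have hsup := le_ciSup (Set.finite_range fun l : Fin L => ‖inner ℂ (bVec B l) h‖ ^ 2).bddAbove l
  have h0 : 0 < ‖h‖ ^ 2 := by positivity
  rw [muSq, div_mul_eq_mul_div, div_div, mul_comm _ (L : ℝ), mul_div_mul_left _ _ hLR.ne']
  gcongr

lemma one_le_muSq (hL : 0 < L) {B : Matrix (Fin L) (Fin K) ℂ} (hB : Bᴴ * B = 1)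
    {h : EuclideanSpace ℂ (Fin K)} (hh : h ≠ 0) : 1 ≤ muSq B h := by
  have hLR : (0 : ℝ) < L := by exact_mod_cast hL
  have h0 : ‖h‖ ^ 2 ≠ 0 := by positivity
  calc (1 : ℝ) = ∑ l, ‖inner ℂ (bVec B l) h‖ ^ 2 / ‖h‖ ^ 2 := by
        rw [← Finset.sum_div, sum_norm_inner_bVec_sq hB, div_self h0]
    _ ≤ ∑ _l : Fin L, muSq B h / L :=
        Finset.sum_le_sum fun l _ => norm_inner_bVec_sq_le_muSq hL B hh l
    _ = muSq B h := by
        rw [Finset.sum_const, Finset.card_univ, Fintype.card_fin, nsmul_eq_mul]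
        field_simp

end Assembly

end BlindDeconv

open BlindDeconv

theorem proposition4 :
    ∃ C₁ C₂ C₃ C₄ : ℝ, 0 < C₁ ∧ 0 < C₂ ∧ 0 < C₃ ∧ 0 < C₄ ∧
      ∀ K N L : ℕ, 2 ≤ K → 2 ≤ N →
        C₁ * (K : ℝ) ≤ (L : ℝ) → (L : ℝ) ≤ (K : ℝ) * (N : ℝ) / 36 →
        ∃ B : Matrix (Fin L) (Fin K) ℂ,
          Bᴴ * B = 1 ∧ BlindDeconv.muMaxSq B = 1 ∧
          ∀ (h₀ : EuclideanSpace ℂ (Fin K)) (m₀ : EuclideanSpace ℂ (Fin N)),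
            h₀ ≠ 0 → m₀ ≠ 0 →
            ∀ {Ω : Type*} [MeasurableSpace Ω] (P : Measure Ω) [IsProbabilityMeasure P]
              (C : Ω → Matrix (Fin L) (Fin N) ℂ), BlindDeconv.IsGaussianMatrix P C →
              1 - C₄ * Real.exp (-(C₂ * (K : ℝ) / BlindDeconv.muSq B h₀)) ≤
                P.real {ω |
                  BlindDeconv.minConicSingularValue (BlindDeconv.measurementOp B (C ω))
                    (BlindDeconv.descentCone (BlindDeconv.outer h₀ m₀)) ≤
                  C₃ * √((L : ℝ) / ((K : ℝ) * (N : ℝ)))} := by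
  refine ⟨3, 1 / 4, 36, 2, by norm_num, by norm_num, by norm_num, by norm_num, ?_⟩
  intro K N L hK hN hL1 hL2
  have hKL : 3 * K ≤ L := by exact_mod_cast hL1
  have hLpos : 0 < L := by omega
  have hKR : (0 : ℝ) < K := by exact_mod_cast (by omega : 0 < K)
  have hNR : (0 : ℝ) < N := by exact_mod_cast (by omega : 0 < N)
  have hLR : (0 : ℝ) < L := by exact_mod_cast hLpos
  obtain ⟨B, hB, hmax, S, hSne, hScard, hSupp, J, hJcard, hJ⟩ :=
    exists_sparse_frame (by omega : 0 < K) hKL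
  refine ⟨B, hB, hmax, ?_⟩
  intro h₀ m₀ hh hm Ω _ P _ C hC
  let n₀ : Fin N := ⟨0, by omega⟩
  obtain ⟨u, hu⟩ := exists_orthonormalBasis_smul_eq n₀ hm
  have hmu := one_le_muSq hLpos hB hh
  have hmu0 : 0 < muSq B h₀ := by linarith
  have hh0 : 0 < ‖h₀‖ ^ 2 := by positivity
  set w : Fin L → ℝ := fun l => ‖inner ℂ (bVec B l) h₀‖ ^ 2 / ‖h₀‖ ^ 2 with hw
  set μ := Measure.pi fun _ : Fin L × Fin N => complexGaussian 1 with hμ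
  set bad₁ : Set (Fin L × Fin N → ℂ) := {g | 4 ≤ ∑ l, w l * ‖g (l, n₀)‖ ^ 2}
  set bad₂ : Set (Fin L × Fin N → ℂ) :=
    {g | ∀ k ∈ J, 2 * ((S k).card / N : ℝ) ≤ projSq (S k) n₀ g}
  have hbad₁ : μ.real bad₁ ≤ Real.exp (-(1 / 4 * K / muSq B h₀)) := by
    refine (measureReal_four_le_sum_mul_normSq n₀ w (fun l => by positivity) ?_
      (div_pos hmu0 hLR) fun l => norm_inner_bVec_sq_le_muSq hLpos B hh l).trans ?_
    · rw [hw, ← Finset.sum_div, sum_norm_inner_bVec_sq hB, div_self hh0.ne']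
    · rw [one_div_div]
      gcongr
      linarith
  have hbad₂ : μ.real bad₂ ≤ Real.exp (-(1 / 4 * K / muSq B h₀)) := by
    refine (measureReal_forall_two_mul_le_projSq J S hSne hJ n₀).trans ?_
    have hhalf : (1 / 2 : ℝ) ≤ Real.exp (-(1 / 2)) := by
      linarith [Real.add_one_le_exp (-(1 / 2) : ℝ)]
    have hJ' : (K : ℝ) ≤ 2 * J.card := by exact_mod_cast hJcard
    have hdiv : 1 / 4 * K / muSq B h₀ ≤ 1 / 4 * K := div_le_self (by positivity) hmu
    calc (1 / 2 : ℝ) ^ J.card ≤ Real.exp (-(1 / 2)) ^ J.card := by gcongr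
      _ = Real.exp (J.card * -(1 / 2)) := (Real.exp_nat_mul _ _).symm
      _ ≤ _ := Real.exp_le_exp.2 (by linarith)
  have hm₁ : MeasurableSet bad₁ := measurableSet_le measurable_const (by fun_prop)
  have hm₂ : MeasurableSet bad₂ := by
    have : bad₂ = ⋂ k ∈ J, {g | 2 * ((S k).card / N : ℝ) ≤ projSq (S k) n₀ g} := by
      ext; simp [bad₂]
    rw [this]
    exact Finset.measurableSet_biInter J fun k _ =>
      measurableSet_le measurable_const (measurable_projSq (S k) n₀)
  set X : Ω → Fin L × Fin N → ℂ := fun ω p => inner ℂ (u p.2) (cVec (C ω) p.1) with hX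
  have hlaw : P.map X = μ := map_inner_cVec hC hLpos.ne' u
  have hXm : Measurable X := by
    refine measurable_pi_lambda _ fun p => ?_
    have hcm (j : Fin N) : Measurable fun ω => (dftMatrix L * C ω) p.1 j := by
      simp only [Matrix.mul_apply]
      exact Finset.measurable_sum _ fun i _ => (hC.measurable i j).const_mul _
    simp only [hX, PiLp.inner_apply, cVec, RCLike.inner_apply]
    exact Finset.measurable_sum _ fun j _ => ((hcm j).const_mul _).mul_const _
  -- Both exceptional events together have probability at most `2 exp (-K / (4 μ²))`.
  have hprob : 1 - 2 * Real.exp (-(1 / 4 * K / muSq B h₀)) ≤ P.real (X ⁻¹' (bad₁ ∪ bad₂)ᶜ) := by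
    rw [← map_measureReal_apply hXm (hm₁.union hm₂).compl, hlaw,
      probReal_compl_eq_one_sub (hm₁.union hm₂)]
    linarith [measureReal_union_le (μ := μ) bad₁ bad₂]
  refine hprob.trans (measureReal_mono fun ω hω => ?_)
  simp only [Set.mem_preimage, Set.mem_compl_iff, Set.mem_union, not_or] at hω
  obtain ⟨hω₁, hω₂⟩ := hω
  obtain ⟨k, -, hk⟩ : ∃ k ∈ J, projSq (S k) n₀ (X ω) < 2 * ((S k).card / N : ℝ) := by
    simpa [bad₂] using hω₂
  obtain ⟨v, hv, hvS⟩ := exists_orthogonal_correction (C ω) u n₀ m₀ hu (S k)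
  set r := √((L : ℝ) / (K * N)) with hr
  have hr2 : r ^ 2 = L / (K * N) := Real.sq_sqrt (by positivity)
  have hr0 : 0 < r := Real.sqrt_pos.2 (by positivity)
  -- The sign of `z = s ‖h₀‖ e_k` makes `Re ⟪h₀, z⟫` nonpositive.
  obtain ⟨s, hs, hsk⟩ : ∃ s : ℝ, |s| = 1 ∧ s * (h₀ k).re ≤ 0 := by
    rcases le_total 0 (h₀ k).re with h | h
    · exact ⟨-1, by simp, by linarith⟩
    · exact ⟨1, by simp, by linarith⟩
  refine minConicSingularValue_le B (C ω) h₀ (EuclideanSpace.single k ((s * ‖h₀‖ : ℝ) : ℂ)) m₀ v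
    hh hm hr0 ?_ ?_ ?_ ?_ ?_ ?_
  · refine le_of_sq_le_sq ?_ (by norm_num)
    rw [hr2, div_le_iff₀ (by positivity)]
    linarith
  · simp [hs]
  · have : (inner ℂ h₀ (EuclideanSpace.single k ((s * ‖h₀‖ : ℝ) : ℂ))).re =
        ‖h₀‖ * (s * (h₀ k).re) := by
      rw [EuclideanSpace.inner_single_right, Complex.re_ofReal_mul]
      simp
      ring
    rw [this]
    exact mul_nonpos_of_nonneg_of_nonpos (norm_nonneg _) hsk
  · refine le_of_sq_le_sq ?_ (by positivity)
    rw [hv, mul_pow, mul_pow, hr2]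
    gcongr
    refine hk.le.trans ?_
    calc 2 * ((S k).card / N : ℝ) ≤ 2 * (2 * (L / K : ℝ) / N) := by gcongr; exact hScard k
      _ = 2 ^ 2 * (L / (K * N) : ℝ) := by field_simp
  · intro l
    by_cases hl : l ∈ S k
    · exact Or.inr (hvS l hl)
    · left
      rw [EuclideanSpace.inner_single_right, hSupp k l hl]
      simp
  · have hlt : ∑ l, w l * ‖X ω (l, n₀)‖ ^ 2 < 4 := by simpa [bad₁] using hω₁
    have hterm (l : Fin L) : ‖inner ℂ (bVec B l) h₀‖ ^ 2 * ‖inner ℂ m₀ (cVec (C ω) l)‖ ^ 2 =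
        (‖h₀‖ * ‖m₀‖) ^ 2 * (w l * ‖X ω (l, n₀)‖ ^ 2) := by
      have : ‖inner ℂ m₀ (cVec (C ω) l)‖ = ‖m₀‖ * ‖X ω (l, n₀)‖ := by
        conv_lhs => rw [hu]
        rw [inner_smul_left, norm_mul]
        simp [hX]
      rw [this, hw]
      field_simp
    rw [Finset.sum_congr rfl fun l _ => hterm l, ← Finset.mul_sum, mul_comm 4]
    gcongr
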